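/- For a lattice polytope $Q\subset\mathbb R^d$ (the convex hull of a nonempty finite subset of $\mathbb Z^d$) and $1\le n\le d$, let $L(Q)$ (respectively $L_n(Q)$) be the largest number $m$ of lattice polytopes $Q_1,\dots,Q_m$ of positive dimension whose Minkowski sum $Q_1+\dots+Q_m$ is contained in $Q$ (respectively, is contained in $Q$ and is at most $n$-dimensional); it is $0$ if there are no such polytopes. Put $\lambda(Q)=\sup_{t\ge1}L(tQ)/t$ and $\lambda_n(Q)=\sup_{t\ge 1}L_n(tQ)/t$, where $t$ runs over the positive integers. A function $f:\mathbb N\to\mathbb Q$ is a quasi-polynomial if there are an integer $k\ge1$ and polynomials $p_0,\dots,p_{k-1}\in\mathbb Q[t]$ (its constituents) with $f(t)=p_r(t)$ whenever $t\equiv r \bmod k$, $0\le r<k$; the least such $k$ is the period of $f$; $f$ is quasi-linear if its constituents have degree at most one; and a function is eventually quasi-linear with period at most $k$ if for all large $t$ it coincides with a quasi-linear function of period at most $k$. Theorem. Let $P\subset\mathbb R^d$ be a lattice polytope. The numbers $L(tP)$ ($t\in\mathbb N$) and $\lambda(P)$ are finite, and there is a least integer $k\ge1$ with $\lambda(P)=L(kP)/k$,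 called the period of $P$. The function $t\mapsto L(tP)$ is eventually quasi-linear with period at most $k$. More explicitly, there are integers $c_r$, $0\le r<k$, with $L(rP)\le c_r\le r\lambda(P)$ and $$L(tP)=k\lambda(P)\left\lfloor \frac tk\right\rfloor+c_r$$ whenever $t\equiv r\bmod k$ and $t$ is large enough. Moreover, for every $1\le n\le d$ there is an integer $k_n\ge1$ with $\lambda_n(P)=L_n(k_nP)/k_n$ such that $t\mapsto L_n(tP)$ is eventually quasi-linear with period at most $k_n$; explicitly, there are integers $c_{n,r}$, $0\le r<k_n$, with $0\le c_{n,r}\le r\lambda_n(P)$ and $L_n(tP)=k_n\lambda_n(P)\lfloor t/k_n\rfloor+c_{n,r}$ whenever $t\equiv r\bmod k_n$ and $t$ is large enough. -/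

import Mathlib

open Filter
open scoped Pointwise

noncomputable section

/-- A lattice polytope in `ℝ^d`: the convex hull of a nonempty finite set of integer points. -/
def IsLatticePolytope {d : ℕ} (P : Set (Fin d → ℝ)) : Prop :=
  ∃ V : Finset (Fin d → ℤ), V.Nonempty ∧
    P = convexHull ℝ ((fun (v : Fin d → ℤ) (i : Fin d) => (v i : ℝ)) '' (V : Set (Fin d → ℤ)))

/-- The dimension of the affine span of a nonempty set. -/
def affDim {d : ℕ} (Q : Set (Fin d → ℝ)) : ℕ := Module.finrank ℝ (vectorSpan ℝ Q)

/-- `P` contains a Minkowski sum of `m` lattice polytopes of positive dimension. -/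
def HasDecomposition {d : ℕ} (P : Set (Fin d → ℝ)) (m : ℕ) : Prop :=
  ∃ Q : Fin m → Set (Fin d → ℝ),
    (∀ i, IsLatticePolytope (Q i) ∧ 0 < affDim (Q i)) ∧ ∑ i, Q i ⊆ P

/-- `P` contains an at most `n`-dimensional Minkowski sum of `m` lattice polytopes of positive
dimension. -/
def HasDecompositionOfDim {d : ℕ} (n : ℕ) (P : Set (Fin d → ℝ)) (m : ℕ) : Prop :=
  ∃ Q : Fin m → Set (Fin d → ℝ),
    (∀ i, IsLatticePolytope (Q i) ∧ 0 < affDim (Q i)) ∧ ∑ i, Q i ⊆ P ∧ affDim (∑ i, Q i) ≤ n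

/-- The Minkowski length `L(P)`. It is `0` if `P` contains no lattice polytope of positive
dimension. -/
def minkowskiLength {d : ℕ} (P : Set (Fin d → ℝ)) : ℕ :=
  sSup {m : ℕ | HasDecomposition P m}

/-- The `n`-th Minkowski length `L_n(P)`. -/
def nthMinkowskiLength {d : ℕ} (n : ℕ) (P : Set (Fin d → ℝ)) : ℕ :=
  sSup {m : ℕ | HasDecompositionOfDim n P m}

/-- The rational Minkowski length `λ(P)`, the supremum of `L(tP) / t` over integers `t ≥ 1`. -/
def rationalMinkowskiLength {d : ℕ} (P : Set (Fin d → ℝ)) : ℝ :=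
  sSup {x : ℝ | ∃ t : ℕ, 1 ≤ t ∧ x = (minkowskiLength ((t : ℝ) • P) : ℝ) / (t : ℝ)}

/-- The `n`-th rational Minkowski length `λ_n(P)`, the supremum of `L_n(tP) / t` over integers
`t ≥ 1`. -/
def nthRationalMinkowskiLength {d : ℕ} (n : ℕ) (P : Set (Fin d → ℝ)) : ℝ :=
  sSup {x : ℝ | ∃ t : ℕ, 1 ≤ t ∧ x = (nthMinkowskiLength n ((t : ℝ) • P) : ℝ) / (t : ℝ)}

/-- `k` is the period of `P`: the least `k ≥ 1` with `λ(P) = L(kP) / k`. -/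
def IsPeriodOf {d : ℕ} (P : Set (Fin d → ℝ)) (k : ℕ) : Prop :=
  IsLeast {k : ℕ | 1 ≤ k ∧
    rationalMinkowskiLength P = (minkowskiLength ((k : ℝ) • P) : ℝ) / (k : ℝ)} k

/-- `f(t) = p_r(t)` whenever `t ≡ r` modulo `k`, `0 ≤ r < k`. -/
def HasConstituents (f : ℕ → ℚ) (k : ℕ) (p : ℕ → Polynomial ℚ) : Prop :=
  1 ≤ k ∧ ∀ r < k, ∀ t : ℕ, t ≡ r [MOD k] → f t = (p r).eval (t : ℚ)

/-- `f` is a quasi-polynomial whose period (the least possible modulus) is `k`, and its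
constituents are linear (degree at most one). -/
def IsQuasiLinearOfPeriod (f : ℕ → ℚ) (k : ℕ) : Prop :=
  IsLeast {m : ℕ | ∃ p, HasConstituents f m p} k ∧
    ∃ p, HasConstituents f k p ∧ ∀ r < k, (p r).natDegree ≤ 1

/-- `f` coincides for all large arguments with a quasi-linear function of period at most `k`. -/
def EventuallyQuasiLinear (f : ℕ → ℚ) (k : ℕ) : Prop :=
  ∃ (g : ℕ → ℚ) (k' : ℕ), IsQuasiLinearOfPeriod g k' ∧ k' ≤ k ∧ ∀ᶠ t in atTop, f t = g t

end

/-!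
Replacing every summand by a segment, `L(tP)` counts the segments of a lattice zonotope inside `tP`.
If two of its segments differ by four times a lattice vector, or one of them is twice a lattice
vector, it can be replaced by a zonotope with equally many but shorter segments that, up to
translation, still lies in `tP`. Hence the segments may be taken distinct modulo `4`, and Dickson's
lemma leaves finitely many finite sets `V` of segments that suffice for all `t`. For each `V`, the
zonotopes with segments in `V` and the dilates containing them form a finitely generated monoid, so
the largest number of segments is superadditive in `t` and attains its asymptotic slope. Each `L_n`
is therefore a maximum of finitely many such sequences, which is eventually quasi-linear.
-/

section Sequences

/-- `F k / k` is the largest of the ratios `F t / t`, `t ≥ 1`. The inequality is cleared of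
denominators, so that at `t = 0` it says `F 0 = 0`. -/
def HasMaxSlopeAt (F : ℕ → ℕ) (k : ℕ) : Prop :=
  1 ≤ k ∧ ∀ t, F t * k ≤ F k * t

/-- Superadditivity of a sequence of natural numbers. -/
def IsSuperadditive (f : ℕ → ℕ) : Prop :=
  ∀ s t, f s + f t ≤ f (s + t)

/-- `F` is the pointwise maximum of finitely many superadditive sequences, each of which attains its
largest ratio `f t / t`. -/
def IsFiniteMaxOfSuperadditive (F : ℕ → ℕ) : Prop :=
  ∃ 𝓕 : Set (ℕ → ℕ), 𝓕.Finite ∧ (∀ f ∈ 𝓕, IsSuperadditive f ∧ ∃ k, HasMaxSlopeAt f k) ∧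
    ∀ t, IsGreatest ((· t) '' 𝓕) (F t)

variable {F f b : ℕ → ℕ} {k m : ℕ}

theorem HasMaxSlopeAt.isGreatest (hk : HasMaxSlopeAt F k) :
    IsGreatest {x : ℝ | ∃ t : ℕ, 1 ≤ t ∧ x = (F t : ℝ) / t} ((F k : ℝ) / k) := by
  refine ⟨⟨k, hk.1, rfl⟩, ?_⟩
  rintro _ ⟨t, ht, rfl⟩
  have hk0 : (0 : ℝ) < k := by exact_mod_cast hk.1
  have ht0 : (0 : ℝ) < t := by exact_mod_cast ht
  rw [div_le_div_iff₀ ht0 hk0]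
  exact_mod_cast hk.2 t

theorem HasMaxSlopeAt.of_div_eq (hk : HasMaxSlopeAt F k) (hm : 1 ≤ m)
    (h : (F k : ℝ) / k = F m / m) : HasMaxSlopeAt F m := by
  have hk0 : 0 < k := hk.1
  have hcross : F k * m = F m * k := by
    rw [div_eq_div_iff (by positivity) (by positivity)] at h
    exact_mod_cast h
  refine ⟨hm, fun t => Nat.le_of_mul_le_mul_right ?_ hk0⟩
  calc F t * m * k = F t * k * m := by ring
    _ ≤ F k * t * m := Nat.mul_le_mul_right m (hk.2 t)
    _ = F m * t * k := by rw [mul_right_comm, hcross]; ring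

theorem IsSuperadditive.add_mul_le (hf : IsSuperadditive f) (r j k : ℕ) :
    f r + j * f k ≤ f (r + j * k) := by
  induction j with
  | zero => simp
  | succ j ih =>
    calc f r + (j + 1) * f k = f r + j * f k + f k := by ring
      _ ≤ f (r + j * k) + f k := by gcongr
      _ ≤ f (r + j * k + k) := hf _ _
      _ = f (r + (j + 1) * k) := by ring_nf

theorem HasMaxSlopeAt.of_dvd (hf : IsSuperadditive f) (hk : HasMaxSlopeAt f k) (hm : 1 ≤ m)
    (hkm : k ∣ m) : HasMaxSlopeAt f m := by
  obtain ⟨j, rfl⟩ := hkm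
  refine ⟨hm, fun t => ?_⟩
  calc f t * (k * j) = f t * k * j := by ring
    _ ≤ f k * t * j := Nat.mul_le_mul_right j (hk.2 t)
    _ = j * f k * t := by ring
    _ ≤ (f 0 + j * f k) * t := by gcongr; exact Nat.le_add_left _ _
    _ ≤ f (0 + j * k) * t := by gcongr; exact hf.add_mul_le 0 j k
    _ = f (k * j) * t := by rw [zero_add, mul_comm j]

theorem exists_hasMaxSlopeAt_forall {𝓕 : Set (ℕ → ℕ)} (hfin : 𝓕.Finite)
    (h𝓕 : ∀ f ∈ 𝓕, IsSuperadditive f ∧ ∃ k, HasMaxSlopeAt f k) :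
    ∃ k, 1 ≤ k ∧ ∀ f ∈ 𝓕, HasMaxSlopeAt f k := by
  induction 𝓕, hfin using Set.Finite.induction_on with
  | empty => exact ⟨1, le_rfl, by simp⟩
  | @insert f 𝓕 _ _ ih =>
    obtain ⟨m, hm, hm𝓕⟩ := ih fun g hg => h𝓕 g (Set.mem_insert_of_mem _ hg)
    obtain ⟨hf, k, hk⟩ := h𝓕 f (Set.mem_insert _ _)
    have hkm : 1 ≤ k * m := Nat.mul_pos hk.1 hm
    refine ⟨k * m, hkm, ?_⟩
    rintro g (rfl | hg)
    · exact hk.of_dvd hf hkm (dvd_mul_right k m)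
    · exact (hm𝓕 g hg).of_dvd (h𝓕 g (Set.mem_insert_of_mem _ hg)).1 hkm (dvd_mul_left m k)

/-- The sequences that attain the slope of `F` gain at least `F k` over every `k` steps, and the
others are eventually too small to attain the maximum before or after the step. -/
theorem IsFiniteMaxOfSuperadditive.exists_hasMaxSlopeAt (hF : IsFiniteMaxOfSuperadditive F) :
    ∃ k, HasMaxSlopeAt F k ∧ (∀ᶠ t in atTop, F t + F k ≤ F (t + k)) ∧
      ∀ r j, j * F k ≤ F (r + j * k) := by
  obtain ⟨𝓕, hfin, h𝓕, hF⟩ := hF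
  obtain ⟨k, hk, hk𝓕⟩ := exists_hasMaxSlopeAt_forall hfin h𝓕
  have le_F {f} (hf : f ∈ 𝓕) (t : ℕ) : f t ≤ F t := (hF t).2 ⟨f, hf, rfl⟩
  have hgrowth (r j : ℕ) : j * F k ≤ F (r + j * k) := by
    obtain ⟨f, hf, hfk : f k = F k⟩ := (hF k).1
    calc j * F k ≤ f r + j * f k := by rw [hfk]; exact Nat.le_add_left _ _
      _ ≤ f (r + j * k) := (h𝓕 f hf).1.add_mul_le r j k
      _ ≤ F (r + j * k) := le_F hf _
  refine ⟨k, ⟨hk, fun t => ?_⟩, ?_, hgrowth⟩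
  · obtain ⟨f, hf, hft : f t = F t⟩ := (hF t).1
    rw [← hft]
    exact ((hk𝓕 f hf).2 t).trans (Nat.mul_le_mul_right t (le_F hf k))
  · filter_upwards [eventually_ge_atTop (k * F k)] with t ht
    obtain ⟨f, hf, hft : f t = F t⟩ := (hF t).1
    rcases (le_F hf k).eq_or_lt with hfk | hfk
    · rw [← hft, ← hfk]
      exact ((h𝓕 f hf).1 t k).trans (le_F hf _)
    · have hslope : F t * k ≤ (t / k) * F k * k := by
        have hdiv := Nat.mod_add_div t k
        have hmod := Nat.mod_lt t hk
        have hfF : (f k + 1) * t ≤ F k * t := Nat.mul_le_mul_right t hfk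
        have hft' := (hk𝓕 f hf).2 t
        rw [hft] at hft'
        nlinarith [Nat.mul_le_mul_left (F k) hmod.le]
      calc F t + F k ≤ (t / k) * F k + F k := by gcongr; exact Nat.le_of_mul_le_mul_right hslope hk
        _ = (t / k + 1) * F k := by ring
        _ ≤ F (t % k + (t / k + 1) * k) := hgrowth _ _
        _ = F (t + k) := by congr 1; rw [add_mul, ← add_assoc, one_mul, Nat.mod_add_div']

theorem exists_eventually_eq_of_bddAbove {h : ℕ → ℕ} (hmono : ∀ᶠ j in atTop, h j ≤ h (j + 1))
    (hbdd : BddAbove (Set.range h)) : ∃ c, ∀ᶠ j in atTop, h j = c := by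
  obtain ⟨N, hN⟩ := eventually_atTop.1 hmono
  have hshift : Monotone fun j => h (j + N) :=
    monotone_nat_of_le_succ fun j => by
      simpa only [add_right_comm] using hN (j + N) (Nat.le_add_left _ _)
  have hlim := tendsto_atTop_ciSup hshift (hbdd.mono (Set.range_comp_subset_range (· + N) h))
  rw [tendsto_add_atTop_iff_nat N, nhds_discrete, tendsto_pure] at hlim
  exact ⟨_, hlim⟩

theorem HasMaxSlopeAt.exists_eventually_eq (hk : HasMaxSlopeAt F k)
    (hstep : ∀ᶠ t in atTop, F t + F k ≤ F (t + k)) (hb : ∀ r j, b r + j * F k ≤ F (r + j * k)) :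
    ∃ c : ℕ → ℕ, (∀ r, b r ≤ c r ∧ c r * k ≤ r * F k) ∧
      ∀ᶠ t in atTop, F t = F k * (t / k) + c (t % k) := by
  have hexcess (r : ℕ) : ∃ c, ∀ᶠ j in atTop, F (r + j * k) = j * F k + c := by
    have hlin : Tendsto (fun j => r + j * k) atTop atTop :=
      tendsto_atTop_mono (fun j => (Nat.le_mul_of_pos_right j hk.1).trans (Nat.le_add_left _ r))
        tendsto_id
    obtain ⟨c, hc⟩ := exists_eventually_eq_of_bddAbove (h := fun j => F (r + j * k) - j * F k)
      ((hlin.eventually hstep).mono fun j hj => by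
        rw [add_assoc, ← add_one_mul] at hj
        have := add_one_mul j (F k)
        lia)
      ⟨F k * r, by
        rintro _ ⟨j, rfl⟩
        rw [tsub_le_iff_right]
        refine Nat.le_of_mul_le_mul_right ((hk.2 _).trans ?_) hk.1
        calc F k * (r + j * k) = F k * r * 1 + j * F k * k := by ring
          _ ≤ F k * r * k + j * F k * k := by gcongr; exact hk.1
          _ = (F k * r + j * F k) * k := by ring⟩
    exact ⟨c, hc.mono fun j hj => by have := hb r j; lia⟩
  choose c hc using hexcess
  refine ⟨c, fun r => ?_, ?_⟩
  · obtain ⟨j, hj⟩ := (hc r).exists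
    have hlower := hb r j
    have hupper := hk.2 (r + j * k)
    rw [hj] at hlower hupper
    exact ⟨by lia, by nlinarith⟩
  · have hall : ∀ᶠ j in atTop, ∀ r ∈ Set.Iio k, F (r + j * k) = j * F k + c r :=
      (Set.finite_Iio k).eventually_all.2 fun r _ => hc r
    have hdiv := Nat.tendsto_div_const_atTop (Nat.one_le_iff_ne_zero.1 hk.1)
    filter_upwards [hdiv.eventually hall] with t ht
    simpa only [mul_comm (t / k), Nat.mod_add_div] using ht (t % k) (Nat.mod_lt t hk.1)

/-- The constituents of `g` at its period agree with constituents modulo `k` on infinitely many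
arguments. -/
theorem HasConstituents.exists_isQuasiLinearOfPeriod {g : ℕ → ℚ} {p : ℕ → Polynomial ℚ}
    (hg : HasConstituents g k p) (hp : ∀ r < k, (p r).natDegree ≤ 1) :
    ∃ k' ≤ k, IsQuasiLinearOfPeriod g k' := by
  classical
  have hex : ∃ m, ∃ p, HasConstituents g m p := ⟨k, p, hg⟩
  obtain ⟨q, hq⟩ := Nat.find_spec hex
  set k' := Nat.find hex
  refine ⟨k', Nat.find_min' hex ⟨p, hg⟩,
    ⟨Nat.find_spec hex, fun _ => Nat.find_min' hex⟩, q, hq, fun r hr => ?_⟩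
  have heq : q r = p (r % k) := by
    refine Polynomial.eq_of_infinite_eval_eq _ _ (Set.infinite_of_injective_forall_mem
      (f := fun j : ℕ => ((r + j * (k' * k) : ℕ) : ℚ)) (fun i j hij => ?_) fun j => ?_)
    · simp only [Nat.cast_inj] at hij
      have hpos : 0 < k' * k := Nat.mul_pos hq.1 hg.1
      exact Nat.eq_of_mul_eq_mul_right hpos (Nat.add_left_cancel hij)
    · rw [Set.mem_ofPred_eq, ← hq.2 r hr, ← hg.2 _ (Nat.mod_lt r hg.1)]
      · simp [Nat.ModEq, ← mul_assoc]
      · simp [Nat.ModEq, mul_left_comm _ k']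
  rw [heq]
  exact hp _ (Nat.mod_lt r hg.1)

theorem EventuallyQuasiLinear.of_eventually_eq_mul_div_add (hk : 1 ≤ k) (a : ℕ) (c : ℕ → ℕ)
    (hF : ∀ᶠ t in atTop, F t = a * (t / k) + c (t % k)) :
    EventuallyQuasiLinear (fun t => (F t : ℚ)) k := by
  have hk0 : (k : ℚ) ≠ 0 := by exact_mod_cast Nat.one_le_iff_ne_zero.1 hk
  have hconst : HasConstituents (fun t => ((a * (t / k) + c (t % k) : ℕ) : ℚ)) k
      fun r => .C (a / k : ℚ) * .X + .C (c r - a / k * r) := by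
    refine ⟨hk, fun r hr t ht => ?_⟩
    have hr' : t % k = r := Nat.mod_eq_of_modEq ht hr
    have ht' : (t : ℚ) = r + k * (t / k : ℕ) := by exact_mod_cast hr' ▸ (Nat.mod_add_div t k).symm
    simp only [Polynomial.eval_add, Polynomial.eval_mul, Polynomial.eval_C, Polynomial.eval_X]
    rw [hr', ht']
    push_cast
    field_simp
    ring
  obtain ⟨k', hk', hg⟩ := hconst.exists_isQuasiLinearOfPeriod
    fun _ _ => Polynomial.natDegree_linear_le
  exact ⟨_, k', hg, hk', hF.mono fun t ht => congrArg Nat.cast ht⟩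

theorem HasMaxSlopeAt.eventuallyQuasiLinear_and_exists_floor_formula (hk : HasMaxSlopeAt F k)
    (hstep : ∀ᶠ t in atTop, F t + F k ≤ F (t + k)) (hb : ∀ r j, b r + j * F k ≤ F (r + j * k))
    {μ : ℝ} (hμ : μ = F k / k) :
    EventuallyQuasiLinear (fun t => (F t : ℚ)) k ∧
      ∃ c : ℕ → ℤ, ∀ r < k, (b r : ℤ) ≤ c r ∧ (c r : ℝ) ≤ r * μ ∧
        ∀ᶠ t : ℕ in atTop, t ≡ r [MOD k] → (F t : ℝ) = k * μ * (t / k : ℕ) + c r := by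
  obtain ⟨c, hc, hF⟩ := hk.exists_eventually_eq hstep hb
  have hk0 : (0 : ℝ) < k := by exact_mod_cast hk.1
  refine ⟨.of_eventually_eq_mul_div_add hk.1 (F k) c hF, fun r => c r, fun r hr =>
    ⟨Nat.cast_le.2 (hc r).1, ?_, hF.mono fun t ht htr => ?_⟩⟩
  · rw [Int.cast_natCast, hμ, ← mul_div_assoc, le_div_iff₀ hk0]
    exact_mod_cast (hc r).2
  · rw [hμ, mul_div_cancel₀ _ hk0.ne', ht, Nat.mod_eq_of_modEq htr hr]
    push_cast
    rfl

end Sequences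

section Zonotopes

/-- How far the segment `[0, v]` reaches below the origin in the direction `u j`. -/
def segmentDepth {M ι : Type*} [AddCommGroup M] (u : ι → M →+ ℤ) (j : ι) (v : M) : ℕ :=
  (-u j v).toNat

/-- Some translate of the zonotope `∑ v ∈ s, [0, v]` satisfies the inequalities
`0 ≤ u j y + t * h j`, which stand for the `t`-th dilate of a polytope. -/
def ZonotopeFits {M ι : Type*} [AddCommGroup M] (u : ι → M →+ ℤ) (h : ι → ℤ) (t : ℕ)
    (s : Multiset M) : Prop :=
  ∃ a, ∀ j, ((s.map (segmentDepth u j)).sum : ℤ) ≤ u j a + t * h j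

/-- The numbers of segments of the zonotopes that fit into the `t`-th dilate and whose segments
`[0, v]` have `v ∈ A`. -/
def segmentCounts {M ι : Type*} [AddCommGroup M] (u : ι → M →+ ℤ) (h : ι → ℤ) (A : Set M)
    (t : ℕ) : Set ℕ :=
  {m | ∃ s : Multiset M, s.card = m ∧ (∀ v ∈ s, v ∈ A) ∧ ZonotopeFits u h t s}

variable {M ι : Type*} [AddCommGroup M] {u : ι → M →+ ℤ} {h : ι → ℤ} {A B : Set M}
  {s s' : Multiset M} {t t' m m' : ℕ}

theorem ZonotopeFits.mono (hs : ZonotopeFits u h t s)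
    (hle : ∀ j, (s'.map (segmentDepth u j)).sum ≤ (s.map (segmentDepth u j)).sum) :
    ZonotopeFits u h t s' :=
  hs.imp fun _ ha j => (Int.ofNat_le.2 (hle j)).trans (ha j)

theorem ZonotopeFits.add (hs : ZonotopeFits u h t s) (hs' : ZonotopeFits u h t' s') :
    ZonotopeFits u h (t + t') (s + s') := by
  obtain ⟨a, ha⟩ := hs
  obtain ⟨a', ha'⟩ := hs'
  refine ⟨a + a', fun j => ?_⟩
  rw [Multiset.map_add, Multiset.sum_add, map_add, Nat.cast_add, Nat.cast_add, add_mul]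
  linarith [ha j, ha' j]

theorem ZonotopeFits.zero (ha : ∃ a, ∀ j, 0 ≤ u j a + h j) (t : ℕ) : ZonotopeFits u h t 0 := by
  obtain ⟨a, ha⟩ := ha
  refine ⟨t • a, fun j => ?_⟩
  rw [map_nsmul, nsmul_eq_mul, ← mul_add]
  simpa using mul_nonneg (Int.natCast_nonneg t) (ha j)

theorem segmentCounts_mono (hAB : A ⊆ B) : segmentCounts u h A t ⊆ segmentCounts u h B t :=
  fun _ ⟨s, hcard, hA, hs⟩ => ⟨s, hcard, fun v hv => hAB (hA v hv), hs⟩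

theorem add_mem_segmentCounts (hm : m ∈ segmentCounts u h A t)
    (hm' : m' ∈ segmentCounts u h A t') : m + m' ∈ segmentCounts u h A (t + t') := by
  obtain ⟨s, rfl, hA, hs⟩ := hm
  obtain ⟨s', rfl, hA', hs'⟩ := hm'
  exact ⟨s + s', Multiset.card_add s s', fun v hv => (Multiset.mem_add.1 hv).elim (hA v) (hA' v),
    hs.add hs'⟩

theorem zero_mem_segmentCounts (ha : ∃ a, ∀ j, 0 ≤ u j a + h j) (A : Set M) (t : ℕ) :
    0 ∈ segmentCounts u h A t :=
  ⟨0, rfl, by simp, .zero ha t⟩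

section Shortening

variable [Fintype ι]

/-- A positive definite quadratic form if the functionals `u j` separate points. Replacing segments
by shorter ones for this form terminates. -/
def energy (u : ι → M →+ ℤ) (v : M) : ℕ :=
  ∑ j, (u j v).natAbs ^ 2

theorem energy_pos (hu : ∀ v, (∀ j, 0 ≤ u j v) → v = 0) {v : M} (hv : v ≠ 0) : 0 < energy u v := by
  obtain ⟨j, hj⟩ : ∃ j, u j v ≠ 0 := by
    by_contra! hzero
    exact hv (hu v fun j => (hzero j).ge)
  exact Finset.sum_pos' (fun _ _ => Nat.zero_le _)
    ⟨j, Finset.mem_univ j, pow_pos (Int.natAbs_pos.2 hj) 2⟩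

theorem energy_two_zsmul (v : M) : energy u ((2 : ℤ) • v) = 4 * energy u v := by
  simp [energy, Finset.mul_sum, Int.natAbs_mul, mul_pow]

theorem energy_add_energy_midpoint (w z : M) :
    energy u (w + (4 : ℤ) • z) + energy u w =
      2 * energy u (w + (2 : ℤ) • z) + 8 * energy u z := by
  simp only [energy, Finset.mul_sum, ← Finset.sum_add_distrib]
  refine Finset.sum_congr rfl fun j _ => ?_
  zify
  simp only [sq_abs, map_add, map_zsmul, smul_eq_mul]
  ring

/-- The configuration `s` of segments has the least energy among those of the same cardinality that
fit into the `t`-th dilate and have their segments in `A`. -/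
def IsShortest (u : ι → M →+ ℤ) (h : ι → ℤ) (A : Set M) (t : ℕ) (s : Multiset M) : Prop :=
  MinimalFor
    (fun s' : Multiset M => s'.card = s.card ∧ (∀ v ∈ s', v ∈ A) ∧ ZonotopeFits u h t s')
    (fun s' => (s'.map (energy u)).sum) s

theorem exists_isShortest (hm : m ∈ segmentCounts u h A t) :
    ∃ s, s.card = m ∧ IsShortest u h A t s := by
  obtain ⟨s, hs⟩ := exists_minimalFor_of_wellFoundedLT _
    (fun s : Multiset M => (s.map (energy u)).sum) hm
  obtain rfl := hs.1.1
  exact ⟨s, rfl, hs⟩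

theorem IsShortest.sum_energy_le {p p' : Multiset M} (hs : IsShortest u h A t s) (hp : p ≤ s)
    (hcard : p'.card = p.card) (hA : ∀ v ∈ p', v ∈ A)
    (hdepth : ∀ j, (p'.map (segmentDepth u j)).sum ≤ (p.map (segmentDepth u j)).sum) :
    (p.map (energy u)).sum ≤ (p'.map (energy u)).sum := by
  obtain ⟨r, rfl⟩ := Multiset.le_iff_exists_add.1 hp
  obtain ⟨⟨-, hpA, hfits⟩, hmin⟩ := hs
  have hle := @hmin (p' + r)
  simp only [Multiset.card_add, Multiset.map_add, Multiset.sum_add, Multiset.mem_add] at hle hpA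
  by_contra! hlt
  refine absurd (hle ⟨by rw [hcard], fun v hv => hv.elim (hA v) fun hv => hpA v (.inr hv),
    hfits.mono fun j => ?_⟩ (by lia)) (by lia)
  simp only [Multiset.map_add, Multiset.sum_add]
  exact Nat.add_le_add_right (hdepth j) _

variable {N : AddSubgroup M}

/-- Otherwise replace `2z` by `z`. -/
theorem IsShortest.two_zsmul_notMem (hu : ∀ v, (∀ j, 0 ≤ u j v) → v = 0)
    (hN : ∀ z, (2 : ℤ) • z ∈ N → z ∈ N) (hs : IsShortest u h (N \ {0}) t s) (z : M) :
    (2 : ℤ) • z ∉ s := by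
  intro hz
  obtain ⟨hzN, hz0⟩ := hs.1.2.1 _ hz
  have hz0 : z ≠ 0 := fun h0 => hz0 (by simp [h0])
  have hle := hs.sum_energy_le (p' := {z}) (Multiset.singleton_le.2 hz) rfl
    (by simpa using ⟨hN z hzN, hz0⟩) fun j => by
      simp only [Multiset.map_singleton, Multiset.sum_singleton, segmentDepth, map_zsmul,
        smul_eq_mul]
      lia
  simp only [Multiset.map_singleton, Multiset.sum_singleton, energy_two_zsmul] at hle
  have := energy_pos hu hz0
  lia

/-- Otherwise replace `w` and `w + 4z` by two copies of their midpoint. -/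
theorem IsShortest.eq_zero_of_add_four_zsmul_mem (hu : ∀ v, (∀ j, 0 ≤ u j v) → v = 0)
    (hN : ∀ z, (2 : ℤ) • z ∈ N → z ∈ N) (hs : IsShortest u h (N \ {0}) t s) {w z : M}
    (hw : w ∈ s) (hwz : w + (4 : ℤ) • z ∈ s) : z = 0 := by
  by_contra hz
  have hmid0 : w + (2 : ℤ) • z ≠ 0 := fun h0 => hs.two_zsmul_notMem hu hN z <| by
    rwa [show w + (4 : ℤ) • z = w + (2 : ℤ) • z + (2 : ℤ) • z by module, h0, zero_add] at hwz
  have hmidN : w + (2 : ℤ) • z ∈ N := hN _ <| by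
    rw [show (2 : ℤ) • (w + (2 : ℤ) • z) = (w + (4 : ℤ) • z) + w by module]
    exact N.add_mem (hs.1.2.1 _ hwz).1 (hs.1.2.1 _ hw).1
  have hne : w ≠ w + (4 : ℤ) • z := fun heq => hz <| hu z fun j => by
    have huz : u j z = 0 := by simpa using congrArg (u j) heq
    exact huz.ge
  have hpair : {w, w + (4 : ℤ) • z} ≤ s :=
    (Multiset.cons_le_of_notMem (by simpa using hne)).2 ⟨hw, Multiset.singleton_le.2 hwz⟩
  have hle := hs.sum_energy_le (p' := {w + (2 : ℤ) • z, w + (2 : ℤ) • z}) hpair rfl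
    (by simpa using ⟨hmidN, hmid0⟩) fun j => by
      simp only [Multiset.insert_eq_cons, Multiset.map_cons, Multiset.map_singleton,
        Multiset.sum_cons, Multiset.sum_singleton, segmentDepth, map_add, map_zsmul, smul_eq_mul]
      lia
  simp only [Multiset.insert_eq_cons, Multiset.map_cons, Multiset.map_singleton,
    Multiset.sum_cons, Multiset.sum_singleton] at hle
  have := energy_add_energy_midpoint (u := u) w z
  have := energy_pos hu hz
  lia

theorem IsShortest.exists_representatives (hu : ∀ v, (∀ j, 0 ≤ u j v) → v = 0)
    (hN : ∀ z, (2 : ℤ) • z ∈ N → z ∈ N) (hs : IsShortest u h (N \ {0}) t s) :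
    ∃ x : M ⧸ (zsmulAddGroupHom (α := M) 4).range → M, (∀ c, x c ∈ N) ∧ ∀ v ∈ s, x v = v := by
  let residue (v : {v // v ∈ s}) : M ⧸ (zsmulAddGroupHom (α := M) 4).range := (v : M)
  have hinj : Function.Injective residue := by
    rintro ⟨v, hv⟩ ⟨w, hw⟩ hvw
    obtain ⟨z, hz⟩ := QuotientAddGroup.eq_iff_sub_mem.1 hvw
    obtain rfl : v = w + (4 : ℤ) • z := sub_eq_iff_eq_add'.1 hz.symm
    simp [hs.eq_zero_of_add_four_zsmul_mem hu hN hw hv]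
  refine ⟨Function.extend residue Subtype.val 0, fun c => ?_,
    fun v hv => hinj.extend_apply _ _ ⟨v, hv⟩⟩
  by_cases hc : ∃ v, residue v = c
  · obtain ⟨v, rfl⟩ := hc
    rw [hinj.extend_apply]
    exact (hs.1.2.1 _ v.2).1
  · rw [Function.extend_apply' _ _ c hc]
    exact N.zero_mem

end Shortening

/-- A consequence of **Dickson's lemma**. -/
theorem exists_finite_forall_exists_le {α β : Type*} [PartialOrder β] [WellQuasiOrderedLE β]
    (f : α → β) : ∃ S : Set α, S.Finite ∧ ∀ a, ∃ b ∈ S, f b ≤ f a := by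
  have hfin : {y | Minimal (· ∈ Set.range f) y}.Finite :=
    WellQuasiOrderedLE.finite_of_isAntichain (setOfPred_minimal_antichain _)
  have hpreimage (y : {y | Minimal (· ∈ Set.range f) y}) : ∃ a, f a = y := y.2.1
  choose g hg using hpreimage
  have := hfin.to_subtype
  refine ⟨Set.range g, Set.finite_range g, fun a => ?_⟩
  obtain ⟨y, hya, hy⟩ := exists_minimal_le_of_wellFoundedLT (· ∈ Set.range f) (f a) ⟨a, rfl⟩
  exact ⟨g ⟨y, hy⟩, ⟨_, rfl⟩, (hg ⟨y, hy⟩).trans_le hya⟩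

instance finite_quotient_range_zsmulAddGroupHom_four [AddGroup.FG M] :
    Finite (M ⧸ (zsmulAddGroupHom (α := M) 4).range) :=
  AddCommGroup.finite_of_fg_isAddTorsion _ fun x => by
    obtain ⟨v, rfl⟩ := QuotientAddGroup.mk_surjective x
    refine isOfFinAddOrder_iff_nsmul_eq_zero.2 ⟨4, by simp, ?_⟩
    rw [← QuotientAddGroup.mk_nsmul, QuotientAddGroup.eq_zero_iff]
    exact ⟨v, ofNat_zsmul v 4⟩

/-- A shortest configuration is given by a function on `M / 4M`, so Dickson's lemma applies to the
depths of its values; the additional coordinate records which values vanish. -/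
theorem exists_finite_forall_segmentCounts [Finite ι] [AddGroup.FG M]
    (hu : ∀ v, (∀ j, 0 ≤ u j v) → v = 0) (h : ι → ℤ) {𝒩 : Set (AddSubgroup M)}
    (h𝒩 : ∀ N ∈ 𝒩, ∀ z, (2 : ℤ) • z ∈ N → z ∈ N) :
    ∃ 𝒱 : Set (Set M), 𝒱.Finite ∧ (∀ V ∈ 𝒱, V.Finite ∧ ∃ N ∈ 𝒩, V ⊆ (N : Set M) \ {0}) ∧
      ∀ N ∈ 𝒩, ∀ t, ∀ m ∈ segmentCounts u h (N \ {0}) t, ∃ V ∈ 𝒱, m ∈ segmentCounts u h V t := by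
  classical
  have := Fintype.ofFinite ι
  let κ := M ⧸ (zsmulAddGroupHom (α := M) 4).range
  obtain ⟨S, hS, hSle⟩ := exists_finite_forall_exists_le
    (fun (x : {x : κ → M // ∃ N ∈ 𝒩, ∀ c, x c ∈ N}) c =>
      ((if x.1 c = 0 then 1 else 0 : ℕ), fun j => segmentDepth u j (x.1 c)))
  refine ⟨(fun x => Set.range x.1 \ {0}) '' S, hS.image _, ?_, fun N hN t m hm => ?_⟩
  · rintro _ ⟨⟨x, N, hN, hx⟩, -, rfl⟩
    exact ⟨(Set.finite_range x).sdiff, N, hN,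
      Set.sdiff_subset_sdiff_left (Set.range_subset_iff.2 hx)⟩
  · obtain ⟨s, rfl, hs⟩ := exists_isShortest hm
    obtain ⟨x, hxN, hx⟩ := hs.exists_representatives hu (h𝒩 N hN)
    obtain ⟨y, hyS, hyx⟩ := hSle ⟨x, N, hN, hxN⟩
    refine ⟨_, ⟨y, hyS, rfl⟩, s.map fun v : M => y.1 (v : κ), Multiset.card_map _ _, ?_,
      hs.1.2.2.mono fun j => ?_⟩
    · intro w hw
      obtain ⟨v, hv, rfl⟩ := Multiset.mem_map.1 hw
      refine ⟨⟨_, rfl⟩, fun hy0 => ?_⟩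
      have hle : (if y.1 v = 0 then 1 else 0) ≤ if x v = 0 then 1 else 0 := (hyx v).1
      have hv0 : v ≠ 0 := (hs.1.2.1 v hv).2
      rw [if_pos (Set.mem_singleton_iff.1 hy0), hx v hv, if_neg hv0] at hle
      exact absurd hle (by simp)
    · rw [Multiset.map_map]
      refine Multiset.sum_map_le_sum_map _ _ fun v hv => ?_
      have hle : segmentDepth u j (y.1 v) ≤ segmentDepth u j (x v) := (hyx v).2 j
      rwa [hx v hv] at hle

theorem exists_max_ratio_of_fg {X : Type*} [AddCommMonoid X] {P : AddSubmonoid X} (hP : P.FG)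
    (α β : X →+ ℕ) (hαβ : ∀ x ∈ P, β x = 0 → α x = 0) (hβ : ∃ x ∈ P, β x ≠ 0) :
    ∃ x₀ ∈ P, 1 ≤ β x₀ ∧ ∀ x ∈ P, α x * β x₀ ≤ α x₀ * β x := by
  classical
  obtain ⟨S, rfl⟩ := hP
  have hS : (S.filter (β · ≠ 0)).Nonempty := by
    by_contra hS
    rw [Finset.not_nonempty_iff_eq_empty, Finset.filter_eq_empty_iff] at hS
    obtain ⟨x, hx, hx0⟩ := hβ
    have hker : AddSubmonoid.closure (S : Set X) ≤ AddMonoidHom.mker β :=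
      (AddSubmonoid.closure_le).2 fun y hy => not_not.1 (hS hy)
    exact hx0 (hker hx)
  obtain ⟨x₀, hx₀, hmax⟩ := Finset.exists_max_image _ (fun x => (α x / β x : ℚ)) hS
  rw [Finset.mem_filter] at hx₀
  have hβ₀ : 1 ≤ β x₀ := Nat.one_le_iff_ne_zero.2 hx₀.2
  refine ⟨x₀, AddSubmonoid.subset_closure hx₀.1, hβ₀, fun x hx => ?_⟩
  induction hx using AddSubmonoid.closure_induction with
  | zero => simp
  | add x y _ _ hx hy => simpa only [map_add, add_mul, mul_add] using add_le_add hx hy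
  | mem x hxS =>
    rcases (β x).eq_zero_or_pos with hx0 | hx0
    · simp [hαβ x (AddSubmonoid.subset_closure hxS) hx0]
    · have hle := hmax x (Finset.mem_filter.2 ⟨hxS, hx0.ne'⟩)
      rw [div_le_div_iff₀ (by exact_mod_cast hx0) (by exact_mod_cast hβ₀)] at hle
      exact_mod_cast hle

section FiniteSupply

/-- The triples of a dilation factor `t`, a multiset `s` of elements of `V` whose zonotope fits into
the `t`-th dilate, and the slacks that a suitable translate of this zonotope leaves. -/
def fittingConfigurations (u : ι → M →+ ℤ) (h : ι → ℤ) (V : Set M) :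
    AddSubmonoid (ℕ × Multiset V × (ι → ℕ)) where
  carrier := {x | ∃ a, ∀ j,
    ((x.2.1.map fun v : V => segmentDepth u j v).sum + x.2.2 j : ℤ) = u j a + x.1 * h j}
  zero_mem' := ⟨0, by simp⟩
  add_mem' := by
    rintro x y ⟨a, ha⟩ ⟨b, hb⟩
    refine ⟨a + b, fun j => ?_⟩
    simp only [Prod.fst_add, Prod.snd_add, Pi.add_apply, Multiset.map_add, Multiset.sum_add,
      map_add, Nat.cast_add]
    linarith [ha j, hb j]

variable {V : Set M}

theorem exists_mem_fittingConfigurations_iff {s : Multiset V} :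
    (∃ y, (t, s, y) ∈ fittingConfigurations u h V) ↔ ZonotopeFits u h t (s.map Subtype.val) := by
  simp only [ZonotopeFits, Multiset.map_map, Function.comp_apply]
  constructor
  · rintro ⟨y, a, ha⟩
    exact ⟨a, fun j => (le_add_of_nonneg_right (Int.natCast_nonneg _)).trans (ha j).le⟩
  · rintro ⟨a, ha⟩
    choose y hy using fun j => Int.le.dest (ha j)
    exact ⟨y, a, hy⟩

theorem mem_segmentCounts_iff_exists_mem_fittingConfigurations :
    m ∈ segmentCounts u h V t ↔
      ∃ s y, (t, s, y) ∈ fittingConfigurations u h V ∧ Multiset.card s = m := by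
  constructor
  · rintro ⟨s, rfl, hsV, hs⟩
    lift s to Multiset V using hsV
    obtain ⟨y, hy⟩ := exists_mem_fittingConfigurations_iff.2 hs
    exact ⟨s, y, hy, (Multiset.card_map _ _).symm⟩
  · rintro ⟨s, y, hy, rfl⟩
    refine ⟨s.map Subtype.val, Multiset.card_map _ _, fun v hv => ?_,
      exists_mem_fittingConfigurations_iff.1 ⟨y, hy⟩⟩
    obtain ⟨w, -, rfl⟩ := Multiset.mem_map.1 hv
    exact w.2

theorem fg_fittingConfigurations [Finite ι] (u : ι → M →+ ℤ) (h : ι → ℤ) (hV : V.Finite) :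
    (fittingConfigurations u h V).FG := by
  classical
  have := hV.to_subtype
  have : WellQuasiOrderedLE (Multiset V) :=
    (Finsupp.orderIsoMultiset (ι := V)).wellQuasiOrderedLE_iff.1 inferInstance
  refine AddSubmonoid.fg_of_subtractive ?_
  rintro x ⟨a, ha⟩ y ⟨b, hb⟩
  refine ⟨b - a, fun j => ?_⟩
  have hxy := hb j
  simp only [Prod.fst_add, Prod.snd_add, Pi.add_apply, Multiset.map_add, Multiset.sum_add,
    Nat.cast_add] at hxy
  rw [map_sub]
  linarith [ha j]

theorem eq_zero_of_zero_mem_fittingConfigurations (hu : ∀ v, (∀ j, 0 ≤ u j v) → v = 0)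
    (hV : 0 ∉ V) {s : Multiset V} {y : ι → ℕ} (hs : (0, s, y) ∈ fittingConfigurations u h V) :
    s = 0 := by
  obtain ⟨a, ha⟩ := hs
  simp only [Nat.cast_zero, zero_mul, add_zero] at ha
  obtain rfl : a = 0 := hu a fun j => (ha j).symm ▸ by positivity
  refine Multiset.eq_zero_of_forall_notMem fun v hv => hV ?_
  have hdepth (j : ι) : segmentDepth u j v = 0 := by
    have hle : segmentDepth u j v ≤ (s.map fun v : V => segmentDepth u j v).sum :=
      Multiset.single_le_sum (by simp) _ (Multiset.mem_map_of_mem _ hv)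
    have hsum := ha j
    rw [map_zero] at hsum
    lia
  rw [← hu v fun j => by simpa [segmentDepth] using hdepth j]
  exact v.2

theorem exists_isGreatest_segmentCounts [Finite ι] (hu : ∀ v, (∀ j, 0 ≤ u j v) → v = 0)
    (ha : ∃ a, ∀ j, 0 ≤ u j a + h j) (hV : V.Finite) (hV0 : 0 ∉ V) :
    ∃ f, (IsSuperadditive f ∧ ∃ k, HasMaxSlopeAt f k) ∧
      ∀ t, IsGreatest (segmentCounts u h V t) (f t) := by
  obtain ⟨s₁, y₁, h₁, -⟩ := mem_segmentCounts_iff_exists_mem_fittingConfigurations.1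
    (zero_mem_segmentCounts ha V 1)
  obtain ⟨⟨k, s, y⟩, hs, hk, hmax⟩ := exists_max_ratio_of_fg (fg_fittingConfigurations u h hV)
    (Multiset.cardHom.comp ((AddMonoidHom.fst _ _).comp (AddMonoidHom.snd _ _)))
    (AddMonoidHom.fst _ _)
    (by
      rintro ⟨_, s, y⟩ hs rfl
      simp [eq_zero_of_zero_mem_fittingConfigurations hu hV0 hs])
    ⟨_, h₁, one_ne_zero⟩
  have hslope {t m : ℕ} (hm : m ∈ segmentCounts u h V t) : m * k ≤ s.card * t := by
    obtain ⟨s', y', hs', rfl⟩ := mem_segmentCounts_iff_exists_mem_fittingConfigurations.1 hm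
    exact hmax _ hs'
  have hgreatest (t : ℕ) : IsGreatest (segmentCounts u h V t) (sSup (segmentCounts u h V t)) := by
    have hbdd : BddAbove (segmentCounts u h V t) :=
      ⟨s.card * t, fun m hm => (Nat.le_mul_of_pos_right m hk).trans (hslope hm)⟩
    exact ⟨Nat.sSup_mem ⟨0, zero_mem_segmentCounts ha V t⟩ hbdd, fun _ => le_csSup hbdd⟩
  refine ⟨_, ⟨fun t t' => (hgreatest _).2 (add_mem_segmentCounts (hgreatest t).1 (hgreatest t').1),
    k, hk, fun t => (hslope (hgreatest t).1).trans ?_⟩, hgreatest⟩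
  exact Nat.mul_le_mul_right t ((hgreatest k).2
    (mem_segmentCounts_iff_exists_mem_fittingConfigurations.2 ⟨s, y, hs, rfl⟩))

end FiniteSupply

theorem exists_isGreatest_iUnion_segmentCounts [Finite ι] [AddGroup.FG M]
    (hu : ∀ v, (∀ j, 0 ≤ u j v) → v = 0) (ha : ∃ a, ∀ j, 0 ≤ u j a + h j)
    {𝒩 : Set (AddSubgroup M)} (h𝒩 : ∀ N ∈ 𝒩, ∀ z, (2 : ℤ) • z ∈ N → z ∈ N) (hne : 𝒩.Nonempty) :
    ∃ F, IsFiniteMaxOfSuperadditive F ∧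
      ∀ t, IsGreatest (⋃ N ∈ 𝒩, segmentCounts u h (N \ {0}) t) (F t) := by
  obtain ⟨𝒱, hfin, h𝒱, hcover⟩ := exists_finite_forall_segmentCounts hu h h𝒩
  have hmaxima (V : Set M) (hV : V ∈ 𝒱) : ∃ f, (IsSuperadditive f ∧ ∃ k, HasMaxSlopeAt f k) ∧
      ∀ t, IsGreatest (segmentCounts u h V t) (f t) := by
    obtain ⟨hVfin, N, -, hVN⟩ := h𝒱 V hV
    exact exists_isGreatest_segmentCounts hu ha hVfin fun h0 => (hVN h0).2 rfl
  choose! f hf hgreatest using hmaxima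
  have h𝒱ne : 𝒱.Nonempty := by
    obtain ⟨N, hN⟩ := hne
    obtain ⟨V, hV, -⟩ := hcover N hN 0 0 (zero_mem_segmentCounts ha _ 0)
    exact ⟨V, hV⟩
  choose W hW hmax using fun t => Set.exists_max_image 𝒱 (f · t) hfin h𝒱ne
  refine ⟨fun t => f (W t) t, ⟨f '' 𝒱, hfin.image f, Set.forall_mem_image.2 hf, fun t =>
    ⟨⟨_, ⟨W t, hW t, rfl⟩, rfl⟩, ?_⟩⟩, fun t => ⟨?_, ?_⟩⟩
  · rintro _ ⟨_, ⟨V, hV, rfl⟩, rfl⟩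
    exact hmax t V hV
  · obtain ⟨-, N, hN, hWN⟩ := h𝒱 _ (hW t)
    exact Set.mem_biUnion hN (segmentCounts_mono hWN (hgreatest _ (hW t) t).1)
  · intro m hm
    obtain ⟨N, hN, hm⟩ := Set.mem_iUnion₂.1 hm
    obtain ⟨V, hV, hm⟩ := hcover N hN t m hm
    exact ((hgreatest V hV t).2 hm).trans (hmax t V hV)

theorem mem_segmentCounts_iff_exists_fin :
    m ∈ segmentCounts u h A t ↔ ∃ (v : Fin m → M) (a : M), (∀ i, v i ∈ A) ∧
      ∀ j, (∑ i, segmentDepth u j (v i) : ℤ) ≤ u j a + t * h j := by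
  constructor
  · rintro ⟨s, rfl, hA, a, ha⟩
    induction s using Quotient.inductionOn with | _ l
    refine ⟨l.get, a, fun i => hA _ (l.get_mem i), fun j => ?_⟩
    have hsum : ∑ i, segmentDepth u j (l.get i) = (l.map (segmentDepth u j)).sum := by
      simp [← Fin.sum_univ_fun_getElem]
    have hj : ((l.map (segmentDepth u j)).sum : ℤ) ≤ u j a + t * h j := ha j
    rw [← hsum] at hj
    exact_mod_cast hj
  · rintro ⟨v, a, hA, ha⟩
    refine ⟨Finset.univ.val.map v, by simp, fun w hw => ?_, a, fun j => ?_⟩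
    · obtain ⟨i, -, rfl⟩ := Multiset.mem_map.1 hw
      exact hA i
    · rw [Multiset.map_map]
      change ((∑ i, segmentDepth u j (v i) : ℕ) : ℤ) ≤ _
      exact_mod_cast ha j

theorem sum_segmentDepth_le_iff {κ : Type*} [Fintype κ] {v : κ → M} {a : M} {j : ι} {c : ℤ} :
    (∑ i, segmentDepth u j (v i) : ℤ) ≤ u j a + c ↔
      ∀ I : Finset κ, 0 ≤ u j (a + ∑ i ∈ I, v i) + c := by
  classical
  have hneg (i : κ) : -(segmentDepth u j (v i) : ℤ) = if u j (v i) < 0 then u j (v i) else 0 := by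
    rw [segmentDepth]
    lia
  have hle (i : κ) : -(segmentDepth u j (v i) : ℤ) ≤ u j (v i) := by
    rw [segmentDepth]
    lia
  simp only [map_add, map_sum]
  constructor
  · intro hsum I
    have hI : -∑ i ∈ I, (segmentDepth u j (v i) : ℤ) ≤ ∑ i ∈ I, u j (v i) := by
      rw [← Finset.sum_neg_distrib]
      exact Finset.sum_le_sum fun i _ => hle i
    have huniv : ∑ i ∈ I, (segmentDepth u j (v i) : ℤ) ≤ ∑ i, (segmentDepth u j (v i) : ℤ) :=
      Finset.sum_le_univ_sum_of_nonneg fun i => Int.natCast_nonneg _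
    linarith
  · intro hI
    have hsum := hI {i | u j (v i) < 0}
    rw [Finset.sum_filter, ← Finset.sum_congr rfl fun i _ => hneg i, Finset.sum_neg_distrib] at hsum
    linarith

end Zonotopes

section Cones

variable {V : Type*} [AddCommGroup V] [Module ℝ V] {S : Set (V →ₗ[ℝ] ℝ)} {G Λ : Set V} {g : V}

theorem mem_hull_insert_iff (hSG : ∀ y, y ∈ PointedCone.hull ℝ G ↔ ∀ f ∈ S, 0 ≤ f y) (y : V) :
    y ∈ PointedCone.hull ℝ (insert g G) ↔ ∃ c, 0 ≤ c ∧ ∀ f ∈ S, c * f g ≤ f y := by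
  rw [PointedCone.hull, Submodule.mem_span_insert]
  constructor
  · rintro ⟨c, z, hz, rfl⟩
    refine ⟨c, c.2, fun f hf => ?_⟩
    have hfz := (hSG z).1 hz f hf
    rw [map_add, ← Nonneg.coe_smul, map_smul, smul_eq_mul]
    linarith
  · rintro ⟨c, hc, hy⟩
    refine ⟨⟨c, hc⟩, y - c • g, (hSG _).2 fun f hf => ?_, ?_⟩
    · simpa using hy f hf
    · rw [Nonneg.mk_smul, add_sub_cancel]

theorem exists_nonneg_forall_mul_le_iff {α : Type*} {S : Set α} (hS : S.Finite) (a b : α → ℝ) :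
    (∃ c, 0 ≤ c ∧ ∀ f ∈ S, c * a f ≤ b f) ↔ (∀ f ∈ S, 0 ≤ a f → 0 ≤ b f) ∧
      ∀ p ∈ S, ∀ q ∈ S, 0 < a p → a q < 0 → 0 ≤ a p * b q - a q * b p := by
  constructor
  · rintro ⟨c, hc, hcS⟩
    refine ⟨fun f hf haf => (mul_nonneg hc haf).trans (hcS f hf), fun p hp q hq hap haq => ?_⟩
    nlinarith [hcS p hp, hcS q hq]
  · rintro ⟨hnonneg, hpair⟩
    obtain ⟨c, hc, hmax⟩ := Set.exists_max_image
      (insert 0 ((fun q => b q / a q) '' {q ∈ S | a q < 0})) id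
      (((hS.subset (Set.sep_subset _ _)).image _).insert _) (Set.insert_nonempty _ _)
    refine ⟨c, hmax 0 (Set.mem_insert _ _), fun f hf => ?_⟩
    rcases lt_trichotomy (a f) 0 with hneg | hzero | hpos
    · exact (div_le_iff_of_neg hneg).1 (hmax _ (.inr ⟨f, ⟨hf, hneg⟩, rfl⟩))
    · simpa [hzero] using hnonneg f hf hzero.ge
    · rcases hc with rfl | ⟨q, ⟨hq, haq⟩, rfl⟩
      · simpa using hnonneg f hf hpos.le
      · rw [div_mul_eq_mul_div, div_le_iff_of_neg haq]
        linarith [hpair f hf q hq hpos haq]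

/-- The functionals obtained from `S` by one step of **Fourier–Motzkin elimination**: if `S` cuts
out a cone, they cut out the cone generated by it and `g`. -/
def fourierMotzkin (S : Set (V →ₗ[ℝ] ℝ)) (g : V) : Set (V →ₗ[ℝ] ℝ) :=
  {f ∈ S | 0 ≤ f g} ∪
    Set.image2 (fun p q => p g • q - q g • p) {p ∈ S | 0 < p g} {q ∈ S | q g < 0}

theorem finite_fourierMotzkin (hS : S.Finite) (g : V) : (fourierMotzkin S g).Finite :=
  (hS.subset (Set.sep_subset _ _)).union
    ((hS.subset (Set.sep_subset _ _)).image2 _ (hS.subset (Set.sep_subset _ _)))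

theorem mem_intRange_of_mem_fourierMotzkin
    (hS : ∀ f ∈ S, ∀ x ∈ Λ, f x ∈ (Int.castRingHom ℝ).range) (hg : g ∈ Λ) :
    ∀ f ∈ fourierMotzkin S g, ∀ x ∈ Λ, f x ∈ (Int.castRingHom ℝ).range := by
  rintro f (hf | ⟨p, hp, q, hq, rfl⟩) x hx
  · exact hS f hf.1 x hx
  · exact sub_mem (mul_mem (hS p hp.1 g hg) (hS q hq.1 x hx))
      (mul_mem (hS q hq.1 g hg) (hS p hp.1 x hx))

theorem forall_mem_fourierMotzkin_nonneg_iff (hS : S.Finite) (y : V) :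
    (∀ f ∈ fourierMotzkin S g, 0 ≤ f y) ↔ ∃ c, 0 ≤ c ∧ ∀ f ∈ S, c * f g ≤ f y := by
  simp only [exists_nonneg_forall_mul_le_iff hS (· g) (· y), fourierMotzkin, Set.mem_union,
    or_imp, forall_and, Set.forall_mem_image2, Set.mem_ofPred_eq, and_imp, LinearMap.sub_apply,
    LinearMap.smul_apply, smul_eq_mul]
  exact and_congr_right fun _ => ⟨fun hy p hp q hq hpg => hy p hp hpg q hq,
    fun hy p hp hpg q hq => hy p hp q hq hpg⟩

/-- The functionals `e i`, which separate points, cut out the zero cone together with their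
opposites. -/
theorem exists_finite_functionals_hull {κ : Type*} [Finite κ] (e : κ → V →ₗ[ℝ] ℝ)
    (hsep : ∀ y, (∀ i, e i y = 0) → y = 0)
    (he : ∀ i, ∀ x ∈ Λ, e i x ∈ (Int.castRingHom ℝ).range) (hG : G.Finite) (hGΛ : G ⊆ Λ) :
    ∃ S : Set (V →ₗ[ℝ] ℝ), S.Finite ∧ (∀ f ∈ S, ∀ x ∈ Λ, f x ∈ (Int.castRingHom ℝ).range) ∧
      ∀ y, y ∈ PointedCone.hull ℝ G ↔ ∀ f ∈ S, 0 ≤ f y := by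
  induction G, hG using Set.Finite.induction_on with
  | empty =>
    refine ⟨Set.range e ∪ Set.range fun i => -e i, (Set.finite_range _).union (Set.finite_range _),
      ?_, fun y => ?_⟩
    · rintro f (⟨i, rfl⟩ | ⟨i, rfl⟩) x hx
      exacts [he i x hx, neg_mem (he i x hx)]
    · rw [PointedCone.hull, Submodule.span_empty, Submodule.mem_bot]
      refine ⟨by rintro rfl; simp, fun hy => hsep y fun i => le_antisymm ?_ (hy _ (.inl ⟨i, rfl⟩))⟩
      exact neg_nonneg.1 (hy _ (.inr ⟨i, rfl⟩))
  | @insert g G _ _ ih =>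
    obtain ⟨S, hS, hSint, hSG⟩ := ih fun x hx => hGΛ (Set.mem_insert_of_mem _ hx)
    refine ⟨fourierMotzkin S g, finite_fourierMotzkin hS g,
      mem_intRange_of_mem_fourierMotzkin hSint (hGΛ (Set.mem_insert _ _)), fun y => ?_⟩
    rw [forall_mem_fourierMotzkin_nonneg_iff hS, mem_hull_insert_iff hSG]

theorem mem_smul_convexHull_of_mem_hull {A : Set V} (hA : A.Nonempty) {z : V × ℝ}
    (hz : z ∈ PointedCone.hull ℝ ((fun a => (a, (1 : ℝ))) '' A)) :
    0 ≤ z.2 ∧ z.1 ∈ z.2 • convexHull ℝ A := by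
  induction hz using Submodule.span_induction with
  | mem z hz =>
    obtain ⟨a, ha, rfl⟩ := hz
    simpa using subset_convexHull ℝ A ha
  | zero => simp [Set.zero_smul_set (hA.convexHull (𝕜 := ℝ))]
  | add z z' _ _ hz hz' =>
    refine ⟨add_nonneg hz.1 hz'.1, ?_⟩
    rw [Prod.snd_add, (convex_convexHull ℝ A).add_smul hz.1 hz'.1]
    exact Set.add_mem_add hz.2 hz'.2
  | smul c z _ hz =>
    refine ⟨mul_nonneg c.2 hz.1, ?_⟩
    obtain ⟨w, hw, hwz⟩ := hz.2
    exact ⟨w, hw, (mul_smul (c : ℝ) z.2 w).trans (congrArg (c • ·) hwz)⟩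

theorem mem_hull_prod_one_iff {A : Set V} (hA : A.Nonempty) (y : V) {t : ℝ} (ht : 0 ≤ t) :
    (y, t) ∈ PointedCone.hull ℝ ((fun a => (a, (1 : ℝ))) '' A) ↔ y ∈ t • convexHull ℝ A := by
  refine ⟨fun hy => (mem_smul_convexHull_of_mem_hull hA hy).2, ?_⟩
  rintro ⟨w, hw, rfl⟩
  have hw1 : (w, (1 : ℝ)) ∈ PointedCone.hull ℝ ((fun a => (a, (1 : ℝ))) '' A) := by
    have himage : (w, (1 : ℝ)) ∈ convexHull ℝ ((fun a => (a, (1 : ℝ))) '' A) := by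
      rw [← Set.prod_singleton, convexHull_prod, convexHull_singleton]
      exact ⟨hw, rfl⟩
    exact convexHull_min PointedCone.subset_hull (PointedCone.convex _) himage
  simpa using PointedCone.smul_mem _ ht hw1

end Cones

section LatticePolytopes

variable {d : ℕ} {P Q : Set (Fin d → ℝ)}

/-- The inclusion of the integer lattice into `ℝ^d`. -/
def latticeHom (d : ℕ) : (Fin d → ℤ) →+ (Fin d → ℝ) :=
  (Int.castAddHom ℝ).compLeft (Fin d)

theorem latticeHom_injective (d : ℕ) : Function.Injective (latticeHom d) :=
  Int.cast_injective.comp_left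

/-- The inequalities `0 ≤ u j y + t * h j` cut out the lattice points of all dilates `t • P`. -/
def CutsOutDilates {ι : Type*} (u : ι → (Fin d → ℤ) →+ ℤ) (h : ι → ℤ) (P : Set (Fin d → ℝ)) :
    Prop :=
  ∀ (t : ℕ) (y : Fin d → ℤ), latticeHom d y ∈ (t : ℝ) • P ↔ ∀ j, 0 ≤ u j y + t * h j

theorem exists_addMonoidHom_int {A : Type*} [AddGroup A] (f : A →+ ℝ)
    (hf : ∀ x, f x ∈ (Int.castRingHom ℝ).range) : ∃ g : A →+ ℤ, ∀ x, (g x : ℝ) = f x := by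
  choose g hg using hf
  refine ⟨.mk' g fun x y => Int.cast_injective (α := ℝ) ?_, hg⟩
  simpa using (hg (x + y)).trans ((f.map_add x y).trans (congrArg₂ _ (hg x) (hg y)).symm)

theorem IsLatticePolytope.exists_cutsOutDilates (hP : IsLatticePolytope P) :
    ∃ (ι : Type) (_ : Finite ι) (u : ι → (Fin d → ℤ) →+ ℤ) (h : ι → ℤ), CutsOutDilates u h P := by
  obtain ⟨W, hW, rfl⟩ := hP
  let Φ : (Fin d → ℤ) × ℤ →+ (Fin d → ℝ) × ℝ := (latticeHom d).prodMap (Int.castAddHom ℝ)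
  let e (i : Option (Fin d)) : (Fin d → ℝ) × ℝ →ₗ[ℝ] ℝ :=
    i.elim (LinearMap.snd ℝ _ _) fun i => LinearMap.proj i ∘ₗ LinearMap.fst ℝ _ _
  obtain ⟨S, hS, hSint, hSmem⟩ := exists_finite_functionals_hull (Λ := Set.range Φ) e
    (fun y hy => Prod.ext (funext fun i => hy (some i)) (hy none))
    (by
      rintro i _ ⟨v, rfl⟩
      exact i.rec ⟨v.2, rfl⟩ fun i => ⟨v.1 i, rfl⟩)
    ((W.finite_toSet.image (latticeHom d)).image fun a => (a, (1 : ℝ)))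
    (by
      rintro _ ⟨_, ⟨v, -, rfl⟩, rfl⟩
      exact ⟨(v, 1), congrArg _ Int.cast_one⟩)
  choose φ hφ using fun f : S => exists_addMonoidHom_int (f.1.toAddMonoidHom.comp Φ)
    fun x => hSint f f.2 _ ⟨x, rfl⟩
  have hsplit (f : S) (t : ℕ) (y : Fin d → ℤ) :
      φ f (y, 0) + t * φ f (0, 1) = φ f (y, t) := by
    rw [← nsmul_eq_mul, ← map_nsmul, ← map_add]
    simp
  refine ⟨S, hS.to_subtype, fun f => (φ f).comp (AddMonoidHom.inl _ _), fun f => φ f (0, 1),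
    fun t y => ?_⟩
  have hne : (latticeHom d '' (W : Set (Fin d → ℤ))).Nonempty := hW.to_set.image _
  refine (mem_hull_prod_one_iff hne _ t.cast_nonneg).symm.trans ((hSmem _).trans ?_)
  refine SetCoe.forall'.trans (forall_congr' fun f => ?_)
  have hcast : (φ f (y, t) : ℝ) = f.1 (latticeHom d y, (t : ℝ)) := hφ f (y, t)
  rw [← hcast, Int.cast_nonneg_iff, ← hsplit]
  rfl

theorem IsLatticePolytope.exists_latticeHom_mem (hP : IsLatticePolytope P) :
    ∃ a, latticeHom d a ∈ P := by
  obtain ⟨W, ⟨a, ha⟩, rfl⟩ := hP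
  exact ⟨a, subset_convexHull ℝ _ ⟨a, ha, rfl⟩⟩

theorem IsLatticePolytope.convex (hP : IsLatticePolytope P) : Convex ℝ P := by
  obtain ⟨W, -, rfl⟩ := hP
  exact convex_convexHull ℝ _

section CutsOutDilates

variable {ι : Type*} {u : ι → (Fin d → ℤ) →+ ℤ} {h : ι → ℤ}

theorem CutsOutDilates.exists_nonneg (hcut : CutsOutDilates u h P) (hP : IsLatticePolytope P) :
    ∃ a, ∀ j, 0 ≤ u j a + h j := by
  obtain ⟨a, ha⟩ := hP.exists_latticeHom_mem
  exact ⟨a, by simpa using (hcut 1 a).1 (by simpa using ha)⟩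

theorem CutsOutDilates.eq_zero_of_nonneg (hcut : CutsOutDilates u h P) {v : Fin d → ℤ}
    (hv : ∀ j, 0 ≤ u j v) : v = 0 := by
  have hmem := (hcut 0 v).2 (by simpa using hv)
  obtain ⟨w, -, hw⟩ := hmem
  refine latticeHom_injective d ?_
  simpa using hw.symm

end CutsOutDilates

theorem isLatticePolytope_convexHull_pair (a b : Fin d → ℤ) :
    IsLatticePolytope (convexHull ℝ {latticeHom d a, latticeHom d b}) := by
  classical
  refine ⟨{a, b}, Finset.insert_nonempty _ _, ?_⟩
  rw [Finset.coe_pair, Set.image_pair]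
  rfl

theorem affDim_convexHull (A : Set (Fin d → ℝ)) : affDim (convexHull ℝ A) = affDim A := by
  rw [affDim, ← direction_affineSpan, affineSpan_convexHull, direction_affineSpan, affDim]

theorem affDim_pair_pos {x y : Fin d → ℝ} (hxy : x ≠ y) : 0 < affDim {x, y} := by
  rw [affDim, vectorSpan_pair, finrank_span_singleton (vsub_ne_zero.2 hxy)]
  exact one_pos

theorem IsLatticePolytope.exists_segment_subset (hQ : IsLatticePolytope Q) (hdim : 0 < affDim Q) :
    ∃ a v : Fin d → ℤ, v ≠ 0 ∧ {latticeHom d a, latticeHom d (a + v)} ⊆ Q := by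
  obtain ⟨V, -, rfl⟩ := hQ
  obtain ⟨a, ha, b, hb, hab⟩ : (V : Set (Fin d → ℤ)).Nontrivial := by
    rw [← Set.not_subsingleton_iff]
    intro hV
    rw [affDim_convexHull, affDim, vectorSpan_of_subsingleton ℝ (hV.image _), finrank_bot] at hdim
    exact hdim.false
  refine ⟨a, b - a, sub_ne_zero.2 hab.symm, ?_⟩
  rw [add_sub_cancel, Set.pair_subset_iff]
  exact ⟨subset_convexHull ℝ _ ⟨a, ha, rfl⟩, subset_convexHull ℝ _ ⟨b, hb, rfl⟩⟩

section Zonotope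

variable {κ : Type*} {a : Fin d → ℤ} {v : κ → Fin d → ℤ}

/-- The points `a + ∑ i ∈ I, v i`. Their convex hull is the zonotope `a + ∑ i, [0, v i]`. -/
def zonotopePoints (a : Fin d → ℤ) (v : κ → Fin d → ℤ) : Set (Fin d → ℝ) :=
  Set.range fun I : Finset κ => latticeHom d (a + ∑ i ∈ I, v i)

theorem sum_pair_eq_zonotopePoints [Fintype κ] (p v : κ → Fin d → ℤ) :
    ∑ i, {latticeHom d (p i), latticeHom d (p i + v i)} = zonotopePoints (∑ i, p i) v := by
  classical
  ext y
  rw [Set.mem_fintype_sum]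
  constructor
  · rintro ⟨g, hg, rfl⟩
    refine ⟨Finset.univ.filter fun i => g i ≠ latticeHom d (p i), ?_⟩
    simp only [Finset.sum_filter, ← Finset.sum_add_distrib, map_sum]
    refine Finset.sum_congr rfl fun i _ => ?_
    split_ifs with hi
    · exact ((hg i).resolve_left hi).symm
    · simpa using (not_not.1 hi).symm
  · rintro ⟨I, rfl⟩
    refine ⟨fun i => latticeHom d (p i + if i ∈ I then v i else 0), fun i => ?_, ?_⟩
    · dsimp only
      split_ifs
      · exact .inr rfl
      · exact .inl (by rw [add_zero])
    · simp [← map_sum, Finset.sum_add_distrib]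

theorem vectorSpan_zonotopePoints_le_iff {W : Submodule ℝ (Fin d → ℝ)} :
    vectorSpan ℝ (zonotopePoints a v) ≤ W ↔ ∀ i, latticeHom d (v i) ∈ W := by
  rw [zonotopePoints, vectorSpan_range_eq_span_range_vsub_right ℝ _ ∅, Submodule.span_le,
    Set.range_subset_iff]
  simp only [vsub_eq_sub, Finset.sum_empty, add_zero, map_add, add_sub_cancel_left, map_sum,
    SetLike.mem_coe]
  exact ⟨fun hW i => by simpa using hW {i}, fun hW I => sum_mem fun i _ => hW i⟩

variable {ι : Type*} {u : ι → (Fin d → ℤ) →+ ℤ} {h : ι → ℤ}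

theorem CutsOutDilates.zonotopePoints_subset_iff [Fintype κ] (hcut : CutsOutDilates u h P)
    (t : ℕ) : zonotopePoints a v ⊆ (t : ℝ) • P ↔
      ∀ j, (∑ i, segmentDepth u j (v i) : ℤ) ≤ u j a + t * h j := by
  simp only [zonotopePoints, Set.range_subset_iff, hcut t _, sum_segmentDepth_le_iff]
  exact forall_comm

end Zonotope

/-- The subgroups `W ∩ ℤ^d` for the subspaces `W` of dimension at most `n`. -/
def latticeSections (d n : ℕ) : Set (AddSubgroup (Fin d → ℤ)) :=
  (fun W : Submodule ℝ (Fin d → ℝ) => W.toAddSubgroup.comap (latticeHom d)) ''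
    {W | Module.finrank ℝ W ≤ n}

theorem mem_of_two_zsmul_mem_latticeSections {n : ℕ} :
    ∀ N ∈ latticeSections d n, ∀ z, (2 : ℤ) • z ∈ N → z ∈ N := by
  rintro _ ⟨W, -, rfl⟩ z hz
  have hz : latticeHom d ((2 : ℤ) • z) ∈ W := hz
  rw [map_zsmul, ← Int.cast_smul_eq_zsmul ℝ] at hz
  exact (W.smul_mem_iff (by norm_num)).1 hz

theorem latticeSections_nonempty (d n : ℕ) : (latticeSections d n).Nonempty :=
  ⟨_, ⊥, by simp, rfl⟩

theorem top_mem_latticeSections (d : ℕ) : ⊤ ∈ latticeSections d d :=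
  ⟨⊤, by simp, rfl⟩

section Decompositions

variable {ι : Type*} {u : ι → (Fin d → ℤ) →+ ℤ} {h : ι → ℤ} {n m t : ℕ}

theorem CutsOutDilates.mem_iUnion_segmentCounts (hcut : CutsOutDilates u h P)
    (hm : HasDecompositionOfDim n ((t : ℝ) • P) m) :
    m ∈ ⋃ N ∈ latticeSections d n, segmentCounts u h (N \ {0}) t := by
  obtain ⟨Q, hQ, hQP, hdim⟩ := hm
  choose p v hv0 hQseg using fun i => (hQ i).1.exists_segment_subset (hQ i).2
  have hpoints : zonotopePoints (∑ i, p i) v ⊆ ∑ i, Q i := by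
    rw [← sum_pair_eq_zonotopePoints]
    exact Set.finsetSum_subset_finsetSum _ _ _ fun i _ => hQseg i
  refine Set.mem_biUnion ⟨vectorSpan ℝ (∑ i, Q i), hdim, rfl⟩
    (mem_segmentCounts_iff_exists_fin.2 ⟨v, ∑ i, p i, fun i => ⟨?_, hv0 i⟩,
      (hcut.zonotopePoints_subset_iff t).1 (hpoints.trans hQP)⟩)
  exact vectorSpan_zonotopePoints_le_iff.1 (vectorSpan_mono ℝ hpoints) i

theorem CutsOutDilates.hasDecompositionOfDim (hcut : CutsOutDilates u h P) (hP : Convex ℝ P)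
    (hm0 : m ≠ 0) (hm : m ∈ ⋃ N ∈ latticeSections d n, segmentCounts u h (N \ {0}) t) :
    HasDecompositionOfDim n ((t : ℝ) • P) m := by
  obtain ⟨_, ⟨W, hW, rfl⟩, hm⟩ := Set.mem_iUnion₂.1 hm
  obtain ⟨v, a, hv, ha⟩ := mem_segmentCounts_iff_exists_fin.1 hm
  let p : Fin m → Fin d → ℤ := Pi.single ⟨0, Nat.pos_of_ne_zero hm0⟩ a
  have hsum : ∑ i, convexHull ℝ {latticeHom d (p i), latticeHom d (p i + v i)} =
      convexHull ℝ (zonotopePoints a v) := by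
    rw [← convexHull_sum, sum_pair_eq_zonotopePoints, Finset.sum_pi_single',
      if_pos (Finset.mem_univ _)]
  refine ⟨fun i => convexHull ℝ {latticeHom d (p i), latticeHom d (p i + v i)}, fun i =>
    ⟨isLatticePolytope_convexHull_pair _ _, ?_⟩, ?_, ?_⟩
  · rw [affDim_convexHull]
    refine affDim_pair_pos fun heq => (hv i).2 ?_
    simpa using latticeHom_injective d heq
  · rw [hsum]
    exact convexHull_min ((hcut.zonotopePoints_subset_iff t).2 ha) (hP.smul _)
  · rw [hsum, affDim_convexHull]
    exact (Submodule.finrank_mono (vectorSpan_zonotopePoints_le_iff.2 fun i => (hv i).1)).trans hW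

theorem CutsOutDilates.bddAbove_and_nthMinkowskiLength_eq (hcut : CutsOutDilates u h P)
    (hP : Convex ℝ P)
    (hm : IsGreatest (⋃ N ∈ latticeSections d n, segmentCounts u h (N \ {0}) t) m) :
    BddAbove {m | HasDecompositionOfDim n ((t : ℝ) • P) m} ∧
      nthMinkowskiLength n ((t : ℝ) • P) = m := by
  have hle : m ∈ upperBounds {m | HasDecompositionOfDim n ((t : ℝ) • P) m} :=
    fun _ hm' => hm.2 (hcut.mem_iUnion_segmentCounts hm')
  refine ⟨⟨m, hle⟩, (csSup_le' hle).antisymm ?_⟩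
  rcases eq_or_ne m 0 with rfl | hm0
  · exact Nat.zero_le _
  · exact le_csSup ⟨m, hle⟩ (hcut.hasDecompositionOfDim hP hm0 hm.1)

theorem IsLatticePolytope.exists_isGreatest_nthMinkowskiLength (hP : IsLatticePolytope P) (n : ℕ) :
    (∀ t : ℕ, BddAbove {m | HasDecompositionOfDim n ((t : ℝ) • P) m}) ∧
      (IsFiniteMaxOfSuperadditive fun t => nthMinkowskiLength n ((t : ℝ) • P)) ∧
      ∃ (ι : Type) (u : ι → (Fin d → ℤ) →+ ℤ) (h : ι → ℤ), ∀ t : ℕ,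
        IsGreatest (⋃ N ∈ latticeSections d n, segmentCounts u h (N \ {0}) t)
          (nthMinkowskiLength n ((t : ℝ) • P)) := by
  obtain ⟨ι, _, u, h, hcut⟩ := hP.exists_cutsOutDilates
  obtain ⟨F, hF, hmax⟩ := exists_isGreatest_iUnion_segmentCounts
    (fun v => hcut.eq_zero_of_nonneg) (hcut.exists_nonneg hP)
    (mem_of_two_zsmul_mem_latticeSections (n := n)) (latticeSections_nonempty d n)
  have hlength t := hcut.bddAbove_and_nthMinkowskiLength_eq hP.convex (hmax t)
  simp only [(hlength _).2]
  exact ⟨fun t => (hlength t).1, hF, ι, u, h, hmax⟩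

theorem iUnion_segmentCounts_latticeSections_self :
    ⋃ N ∈ latticeSections d d, segmentCounts u h (N \ {0}) t = segmentCounts u h {0}ᶜ t :=
  (Set.iUnion₂_subset fun _ _ => segmentCounts_mono fun _ hv => hv.2).antisymm <| by
    simpa [Set.compl_eq_univ_sdiff] using Set.subset_biUnion_of_mem
      (u := fun N : AddSubgroup _ => segmentCounts u h (N \ {0}) t) (top_mem_latticeSections d)

theorem hasDecompositionOfDim_self_iff : HasDecompositionOfDim d P m ↔ HasDecomposition P m :=
  ⟨fun ⟨Q, hQ, hQP, _⟩ => ⟨Q, hQ, hQP⟩,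
    fun ⟨Q, hQ, hQP⟩ => ⟨Q, hQ, hQP, (Submodule.finrank_le _).trans (by simp)⟩⟩

theorem nthMinkowskiLength_self (P : Set (Fin d → ℝ)) :
    nthMinkowskiLength d P = minkowskiLength P := by
  simp only [nthMinkowskiLength, minkowskiLength, hasDecompositionOfDim_self_iff]

theorem IsLatticePolytope.bddAbove_hasDecomposition (hP : IsLatticePolytope P) (t : ℕ) :
    BddAbove {m | HasDecomposition ((t : ℝ) • P) m} := by
  simpa only [hasDecompositionOfDim_self_iff] using (hP.exists_isGreatest_nthMinkowskiLength d).1 t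

theorem IsLatticePolytope.isSuperadditive_minkowskiLength (hP : IsLatticePolytope P) :
    IsSuperadditive fun t => minkowskiLength ((t : ℝ) • P) := by
  obtain ⟨-, -, ι, u, h, hmax⟩ := hP.exists_isGreatest_nthMinkowskiLength d
  simp only [iUnion_segmentCounts_latticeSections_self, nthMinkowskiLength_self] at hmax
  exact fun t t' => (hmax (t + t')).2 (add_mem_segmentCounts (hmax t).1 (hmax t').1)

theorem IsLatticePolytope.isFiniteMaxOfSuperadditive_nthMinkowskiLength
    (hP : IsLatticePolytope P) (n : ℕ) :
    IsFiniteMaxOfSuperadditive fun t => nthMinkowskiLength n ((t : ℝ) • P) :=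
  (hP.exists_isGreatest_nthMinkowskiLength n).2.1

theorem IsLatticePolytope.exists_isPeriodOf_hasMaxSlopeAt (hP : IsLatticePolytope P) :
    ∃ k, IsPeriodOf P k ∧ HasMaxSlopeAt (fun t => minkowskiLength ((t : ℝ) • P)) k := by
  obtain ⟨k, hk, -⟩ :=
    (hP.isFiniteMaxOfSuperadditive_nthMinkowskiLength d).exists_hasMaxSlopeAt
  simp only [nthMinkowskiLength_self] at hk
  have hrational : rationalMinkowskiLength P = minkowskiLength ((k : ℝ) • P) / k :=
    hk.isGreatest.csSup_eq
  have hmem := Nat.sInf_mem (s := {k : ℕ | 1 ≤ k ∧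
    rationalMinkowskiLength P = minkowskiLength ((k : ℝ) • P) / k}) ⟨k, hk.1, hrational⟩
  exact ⟨_, ⟨hmem, fun _ => Nat.sInf_le⟩, hk.of_div_eq hmem.1 (hrational.symm.trans hmem.2)⟩

end Decompositions

end LatticePolytopes

theorem theoremT {d : ℕ} (P : Set (Fin d → ℝ)) (hP : IsLatticePolytope P) :
    -- the (rational) Minkowski lengths are finite
    (∀ t : ℕ, BddAbove {m : ℕ | HasDecomposition ((t : ℝ) • P) m}) ∧
    BddAbove {x : ℝ | ∃ t : ℕ, 1 ≤ t ∧ x = (minkowskiLength ((t : ℝ) • P) : ℝ) / (t : ℝ)} ∧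
    -- the period exists, and `L(tP)` is eventually quasi-linear with period at most `k`
    (∃ k : ℕ, IsPeriodOf P k ∧
      EventuallyQuasiLinear (fun t : ℕ => (minkowskiLength ((t : ℝ) • P) : ℚ)) k ∧
      ∃ c : ℕ → ℤ, ∀ r < k,
        (minkowskiLength ((r : ℝ) • P) : ℝ) ≤ (c r : ℝ) ∧
        (c r : ℝ) ≤ (r : ℝ) * rationalMinkowskiLength P ∧
        ∀ᶠ t : ℕ in atTop, t ≡ r [MOD k] →
          (minkowskiLength ((t : ℝ) • P) : ℝ) =
            (k : ℝ) * rationalMinkowskiLength P * ((t / k : ℕ) : ℝ) + (c r : ℝ)) ∧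
    -- eventual quasi-linearity of each `n`-th Minkowski length
    (∀ n : ℕ, 1 ≤ n → n ≤ d → ∃ k : ℕ, 1 ≤ k ∧
      nthRationalMinkowskiLength n P = (nthMinkowskiLength n ((k : ℝ) • P) : ℝ) / (k : ℝ) ∧
      EventuallyQuasiLinear (fun t : ℕ => (nthMinkowskiLength n ((t : ℝ) • P) : ℚ)) k ∧
      ∃ c : ℕ → ℤ, ∀ r < k,
        0 ≤ c r ∧
        (c r : ℝ) ≤ (r : ℝ) * nthRationalMinkowskiLength n P ∧
        ∀ᶠ t : ℕ in atTop, t ≡ r [MOD k] →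
          (nthMinkowskiLength n ((t : ℝ) • P) : ℝ) =
            (k : ℝ) * nthRationalMinkowskiLength n P * ((t / k : ℕ) : ℝ) + (c r : ℝ)) := by
  obtain ⟨k, hperiod, hslope⟩ := hP.exists_isPeriodOf_hasMaxSlopeAt
  have hsup := hP.isSuperadditive_minkowskiLength
  refine ⟨hP.bddAbove_hasDecomposition, hslope.isGreatest.bddAbove, ⟨k, hperiod, ?_⟩,
    fun n _ _ => ?_⟩
  · obtain ⟨hquasi, c, hc⟩ := hslope.eventuallyQuasiLinear_and_exists_floor_formula
      (.of_forall fun t => hsup t k) (fun r j => hsup.add_mul_le r j k) hperiod.1.2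
    exact ⟨hquasi, c, fun r hr => ⟨by exact_mod_cast (hc r hr).1, (hc r hr).2⟩⟩
  · obtain ⟨k, hslope, hstep, hmul⟩ :=
      (hP.isFiniteMaxOfSuperadditive_nthMinkowskiLength n).exists_hasMaxSlopeAt
    have hrational : nthRationalMinkowskiLength n P = nthMinkowskiLength n ((k : ℝ) • P) / k :=
      hslope.isGreatest.csSup_eq
    obtain ⟨hquasi, c, hc⟩ := hslope.eventuallyQuasiLinear_and_exists_floor_formula
      (b := 0) hstep (fun r j => by simpa using hmul r j) hrational
    exact ⟨k, hslope.1, hrational, hquasi, c, hc⟩
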